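/- Let $q(G)=q_G(x)\in\mathbb Z[x]$ denote the interlace polynomial of a finite simple undirected graph $G$, i.e. the unique assignment with $q(E_n)=x^n$ for the edgeless graph $E_n$ on $n$ vertices and $q(G)=q(G-a)+q(G^{ab}-b)$ for every edge $ab$ of $G$. Here the pivot $G^{ab}$ is obtained from $G$ by dividing the vertices other than $a,b$ into those adjacent to $a$ alone, to $b$ alone, to both, and to neither, and toggling (edge/non-edge) every pair $xy$ whose members lie in two different ones of the first three classes. Let $P_2$ be the path with two edges (three vertices); a solid $P_2$-graph is a graph obtained from $P_2$ by substituting non-empty complete graphs for its three vertices, all vertices of two substituted graphs being joined exactly when the corresponding vertices of $P_2$ are adjacent. Let $n\ge 3$. Over all graphs $G$ of order $n$, the second-largest value of $q_G(1)$ is $\frac34\,2^{n-1}$, and it is attained exactly when $G$ is a solid $P_2$-graph but not a complete graph. That is, it is attained exactly when $G$ is the union of two complete graphs that share some but not all of their vertices (the vertex sets $A,B$ satisfy $A\cap B\neq\emptyset$, $A\setminus B\neq\emptyset$, $B\setminus A\neq\emptyset$). -/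

import Mathlib

open Polynomial

universe u v

/-- The vertices `x`, `y` (other than `a`, `b`) lie in two different classes among the three
classes "adjacent to `a` alone", "adjacent to `b` alone", "adjacent to both `a` and `b`". -/
def PivotToggles {V : Type*} (G : SimpleGraph V) (a b x y : V) : Prop :=
  (x ≠ a ∧ x ≠ b ∧ (G.Adj a x ∨ G.Adj b x)) ∧
  (y ≠ a ∧ y ≠ b ∧ (G.Adj a y ∨ G.Adj b y)) ∧
  ¬ ((G.Adj a x ↔ G.Adj a y) ∧ (G.Adj b x ↔ G.Adj b y))

/-- The pivot `G^{ab}`: toggle (edge / non-edge) all pairs `x y` of vertices lying in different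
classes. -/
def pivot {V : Type*} (G : SimpleGraph V) (a b : V) : SimpleGraph V where
  Adj x y := ¬ (G.Adj x y ↔ PivotToggles G a b x y)
  symm := ⟨by
    intro x y h
    have e : PivotToggles G a b x y ↔ PivotToggles G a b y x := by
      unfold PivotToggles; tauto
    rwa [e, G.adj_comm x y] at h⟩
  loopless := ⟨by
    intro x h
    simp [PivotToggles] at h⟩

open Classical in
/-- The interlace polynomial of the subgraph of `G` induced by the finite vertex set `S`:
if this subgraph has an edge `ab`, then it is `q(G[S] - a) + q(G[S]^{ab} - b)`
(for one, arbitrarily chosen, edge: the choice does not matter, see `interlaceOn_pivot`);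
if it is edgeless, it is `x ^ |S|`. -/
noncomputable def interlaceOn {V : Type*} (G : SimpleGraph V) (S : Finset V) : ℤ[X] :=
  if h : ∃ e : V × V, e.1 ∈ S ∧ e.2 ∈ S ∧ G.Adj e.1 e.2 then
    interlaceOn G (S.erase h.choose.1) +
      interlaceOn (pivot G h.choose.1 h.choose.2) (S.erase h.choose.2)
  else X ^ S.card
termination_by S.card
decreasing_by
  · exact Finset.card_erase_lt_of_mem h.choose_spec.1
  · exact Finset.card_erase_lt_of_mem h.choose_spec.2.1

/-- The interlace polynomial `q(G)` of a finite graph. -/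
noncomputable def interlacePoly {V : Type*} [Fintype V] (G : SimpleGraph V) : ℤ[X] :=
  interlaceOn G Finset.univ

theorem pivot_comm {V : Type*} (G : SimpleGraph V) (a b : V) : pivot G a b = pivot G b a := by
  ext x y
  have e : PivotToggles G a b x y ↔ PivotToggles G b a x y := by
    unfold PivotToggles; tauto
  simp only [pivot, e]

theorem pivot_adj_left {V : Type*} (G : SimpleGraph V) (a b y : V) :
    (pivot G a b).Adj a y ↔ G.Adj a y := by
  simp [pivot, PivotToggles]

theorem pivot_adj_right {V : Type*} (G : SimpleGraph V) (a b y : V) :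
    (pivot G a b).Adj b y ↔ G.Adj b y := by
  simp [pivot, PivotToggles]

theorem pivot_adj_of_not {V : Type*} (G : SimpleGraph V) (a b c y : V)
    (h1 : ¬ G.Adj a c) (h2 : ¬ G.Adj b c) :
    (pivot G a b).Adj c y ↔ G.Adj c y := by
  simp [pivot, PivotToggles, h1, h2]

theorem pivot_pivot_adj {V : Type*} (G : SimpleGraph V) {a b c : V} (hbc : b ≠ c)
    (hab : G.Adj a b) (hac : G.Adj a c) {x y : V} (hxb : x ≠ b) (hxc : x ≠ c)
    (hyb : y ≠ b) (hyc : y ≠ c) :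
    (pivot (pivot G a b) a c).Adj x y ↔ (pivot G a c).Adj x y := by
  by_cases hxa : x = a
  · subst hxa; rw [pivot_adj_left, pivot_adj_left, pivot_adj_left]
  by_cases hya : y = a
  · subst hya
    rw [SimpleGraph.adj_comm, pivot_adj_left, pivot_adj_left, SimpleGraph.adj_comm _ x,
      pivot_adj_left]
  have hba : b ≠ a := hab.ne'
  have hca : c ≠ a := hac.ne'
  have hcb : c ≠ b := hbc.symm
  have e1 := G.adj_comm b c
  have e2 := G.adj_comm x c
  have e3 := G.adj_comm y c
  have e4 : ¬ G.Adj a a := G.irrefl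
  simp only [pivot, PivotToggles, ne_eq, hxa, hya, hxb, hyb, hxc, hyc, hca, hcb, hac, e4,
    not_true, not_false_eq_true, true_and, true_or, false_and, iff_false]
  by_cases h1 : G.Adj a x <;> by_cases h2 : G.Adj a y <;> by_cases h3 : G.Adj b x <;>
    by_cases h4 : G.Adj b y <;> by_cases h5 : G.Adj c x <;> by_cases h6 : G.Adj c y <;>
    by_cases h7 : G.Adj b c <;> simp [h1, h2, h3, h4, h5, h6, h7]

theorem pivot_pivot_adj_swap {V : Type*} (G : SimpleGraph V) {a b c : V} (hbc : b ≠ c)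
    (hab : G.Adj a b) (hac : G.Adj a c) {y : V} (hya : y ≠ a) (hyb : y ≠ b) (hyc : y ≠ c) :
    (pivot G a b).Adj c y ↔ (pivot (pivot G a c) a b).Adj b y := by
  rw [pivot_adj_right]
  have hba : b ≠ a := hab.ne'
  have hca : c ≠ a := hac.ne'
  have e1 := G.adj_comm b c
  simp only [pivot, PivotToggles]
  grind

theorem interlaceOn_edgeless {V : Type*} (G : SimpleGraph V) (S : Finset V)
    (h : ∀ a ∈ S, ∀ b ∈ S, ¬ G.Adj a b) : interlaceOn G S = X ^ S.card := by
  rw [interlaceOn, dif_neg]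
  rintro ⟨e, h1, h2, h3⟩
  exact h _ h1 _ h2 h3

open Classical in
theorem interlaceOn_exists {V : Type*} (G : SimpleGraph V) (S : Finset V) {a b : V}
    (ha : a ∈ S) (hb : b ∈ S) (hab : G.Adj a b) :
    ∃ c ∈ S, ∃ d ∈ S, G.Adj c d ∧
      interlaceOn G S = interlaceOn G (S.erase c) + interlaceOn (pivot G c d) (S.erase d) := by
  have h : ∃ e : V × V, e.1 ∈ S ∧ e.2 ∈ S ∧ G.Adj e.1 e.2 := ⟨(a, b), ha, hb, hab⟩
  refine ⟨h.choose.1, h.choose_spec.1, h.choose.2, h.choose_spec.2.1, h.choose_spec.2.2, ?_⟩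
  rw [interlaceOn, dif_pos h]

open Classical in
/-- Invariance under relabelling the vertices, given that every edge can be used in the
recursion. -/
theorem interlaceOn_congr_aux {V W : Type*} (n : ℕ)
    (hW : ∀ (H : SimpleGraph W) (T : Finset W) (a b : W), T.card ≤ n → a ∈ T → b ∈ T →
      H.Adj a b → interlaceOn H T =
        interlaceOn H (T.erase a) + interlaceOn (pivot H a b) (T.erase b)) :
    ∀ (m : ℕ) (G : SimpleGraph V) (H : SimpleGraph W) (S : Finset V) (f : V → W),
      m ≤ n → S.card = m → Set.InjOn f S →
      (∀ x ∈ S, ∀ y ∈ S, (G.Adj x y ↔ H.Adj (f x) (f y))) →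
      interlaceOn G S = interlaceOn H (S.image f) := by
  intro m
  induction m with
  | zero =>
    intro G H S f _ hS _ _
    obtain rfl := Finset.card_eq_zero.mp hS
    rw [interlaceOn_edgeless _ _ (by simp), interlaceOn_edgeless _ _ (by simp)]
    simp
  | succ m ih =>
    intro G H S f hm hS hf hadj
    have hcard : (S.image f).card = S.card := Finset.card_image_of_injOn hf
    have himg : ∀ a ∈ S, (S.erase a).image f = (S.image f).erase (f a) := by
      intro a ha
      ext w
      simp only [Finset.mem_image, Finset.mem_erase]
      constructor
      · rintro ⟨x, ⟨hxa, hx⟩, rfl⟩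
        exact ⟨fun h => hxa (hf hx ha h), x, hx, rfl⟩
      · rintro ⟨hne, x, hx, rfl⟩
        exact ⟨x, ⟨fun h => hne (by rw [h]), hx⟩, rfl⟩
    by_cases hE : ∃ a ∈ S, ∃ b ∈ S, G.Adj a b
    · obtain ⟨a', ha', b', hb', hab'⟩ := hE
      obtain ⟨a, ha, b, hb, hab, e⟩ := interlaceOn_exists G S ha' hb' hab'
      rw [e, hW H (S.image f) (f a) (f b) (by omega) (Finset.mem_image_of_mem f ha)
        (Finset.mem_image_of_mem f hb) ((hadj a ha b hb).mp hab), ← himg a ha, ← himg b hb]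
      congr 1
      · refine ih G H _ f (by omega) (by rw [Finset.card_erase_of_mem ha]; omega)
          (hf.mono (by simp)) ?_
        intro x hx y hy
        exact hadj x (Finset.mem_of_mem_erase hx) y (Finset.mem_of_mem_erase hy)
      · refine ih _ _ _ f (by omega) (by rw [Finset.card_erase_of_mem hb]; omega)
          (hf.mono (by simp)) ?_
        intro x hx y hy
        have hx := Finset.mem_of_mem_erase hx
        have hy := Finset.mem_of_mem_erase hy
        simp only [pivot, PivotToggles, hadj x hx y hy, hadj a ha x hx, hadj a ha y hy,
          hadj b hb x hx, hadj b hb y hy, ne_eq, hf.eq_iff hx ha, hf.eq_iff hx hb,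
          hf.eq_iff hy ha, hf.eq_iff hy hb]
    · push Not at hE
      rw [interlaceOn_edgeless G S hE, interlaceOn_edgeless H, hcard]
      intro u hu v hv
      obtain ⟨x, hx, rfl⟩ := Finset.mem_image.mp hu
      obtain ⟨y, hy, rfl⟩ := Finset.mem_image.mp hv
      rw [← hadj x hx y hy]
      exact hE x hx y hy

open Classical in
/-- Every (oriented) edge may be used in the recursion, not just the chosen one. -/
theorem interlaceOn_pivot {V : Type*} (G : SimpleGraph V) (S : Finset V) {a b : V}
    (ha : a ∈ S) (hb : b ∈ S) (hab : G.Adj a b) :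
    interlaceOn G S = interlaceOn G (S.erase a) + interlaceOn (pivot G a b) (S.erase b) := by
  induction hn : S.card using Nat.strong_induction_on generalizing G S a b with
  | _ n ih =>
  have hrec : ∀ (H : SimpleGraph V) (T : Finset V) (a b : V), T.card < n → a ∈ T → b ∈ T →
      H.Adj a b → interlaceOn H T =
        interlaceOn H (T.erase a) + interlaceOn (pivot H a b) (T.erase b) :=
    fun H T a b hT ha hb hab => ih T.card hT H T ha hb hab rfl
  have hiso : ∀ (G H : SimpleGraph V) (T : Finset V) (f : V → V), T.card < n →
      Set.InjOn f T → (∀ x ∈ T, ∀ y ∈ T, (G.Adj x y ↔ H.Adj (f x) (f y))) →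
      interlaceOn G T = interlaceOn H (T.image f) := by
    intro G H T f hT hf hadj
    exact interlaceOn_congr_aux (n - 1) (fun H T a b hT => hrec H T a b (by omega)) T.card
      G H T f (by omega) rfl hf hadj
  have hid : ∀ (G H : SimpleGraph V) (T : Finset V), T.card < n →
      (∀ x ∈ T, ∀ y ∈ T, (G.Adj x y ↔ H.Adj x y)) → interlaceOn G T = interlaceOn H T := by
    intro G H T hT hadj
    simpa using hiso G H T id hT (Set.injOn_id _) hadj
  have lt1 : ∀ a ∈ S, (S.erase a).card < n := fun a ha => hn ▸ Finset.card_erase_lt_of_mem ha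
  have lt2 : ∀ a ∈ S, ∀ b, ((S.erase a).erase b).card < n := fun a ha b =>
    lt_of_le_of_lt (Finset.card_le_card (Finset.erase_subset _ _)) (lt1 a ha)
  have key : ∀ (a b : V), a ∈ S → b ∈ S → G.Adj a b →
      ∀ (c d : V), c ∈ S → d ∈ S → G.Adj c d →
      interlaceOn G (S.erase a) + interlaceOn (pivot G a b) (S.erase b) =
      interlaceOn G (S.erase c) + interlaceOn (pivot G c d) (S.erase d) := by
    -- reversing an edge
    have rev : ∀ (a b : V), a ∈ S → b ∈ S → G.Adj a b →
        interlaceOn G (S.erase a) + interlaceOn (pivot G a b) (S.erase b) =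
        interlaceOn G (S.erase b) + interlaceOn (pivot G b a) (S.erase a) := by
      intro a b ha hb hab
      have triv : (∀ x ∈ S, ∀ y ∈ S, ¬ PivotToggles G a b x y) →
          interlaceOn G (S.erase a) + interlaceOn (pivot G a b) (S.erase b) =
          interlaceOn G (S.erase b) + interlaceOn (pivot G b a) (S.erase a) := by
        intro h
        have e : ∀ c ∈ S, interlaceOn (pivot G a b) (S.erase c) = interlaceOn G (S.erase c) := by
          intro c hc
          refine hid _ _ _ (lt1 c hc) ?_
          intro x hx y hy
          have := h x (Finset.mem_of_mem_erase hx) y (Finset.mem_of_mem_erase hy)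
          simp [pivot, this]
        rw [pivot_comm G b a, e a ha, e b hb, add_comm]
      by_cases hA : ∃ c ∈ S, c ≠ b ∧ G.Adj a c
      swap
      · push Not at hA
        apply triv
        rintro x hx y hy ⟨⟨_, hxb, h1⟩, ⟨_, hyb, h2⟩, h3⟩
        have := hA x hx hxb
        have := hA y hy hyb
        tauto
      by_cases hB : ∃ d ∈ S, d ≠ a ∧ G.Adj b d
      swap
      · push Not at hB
        apply triv
        rintro x hx y hy ⟨⟨hxa, _, h1⟩, ⟨hya, _, h2⟩, h3⟩
        have := hB x hx hxa
        have := hB y hy hya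
        tauto
      obtain ⟨c, hc, hcb, hac⟩ := hA
      obtain ⟨d, hd, hda, hbd⟩ := hB
      have nab := hab.ne
      have nac := hac.ne
      have nbd := hbd.ne
      rw [hrec G (S.erase a) b d (lt1 a ha) (by simp [*, nab.symm]) (by simp [*]) hbd,
        hrec (pivot G a b) (S.erase b) a c (lt1 b hb) (by simp [*]) (by simp [*])
          ((pivot_adj_left G a b c).mpr hac),
        hrec G (S.erase b) a c (lt1 b hb) (by simp [*]) (by simp [*]) hac,
        hrec (pivot G b a) (S.erase a) b d (lt1 a ha) (by simp [*, nab.symm]) (by simp [*])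
          ((pivot_adj_left G b a d).mpr hbd)]
      have e1 : interlaceOn (pivot (pivot G a b) a c) ((S.erase b).erase c) =
          interlaceOn (pivot G a c) ((S.erase b).erase c) := by
        refine hid _ _ _ (lt2 b hb c) ?_
        intro x hx y hy
        simp only [Finset.mem_erase] at hx hy
        exact pivot_pivot_adj G hcb.symm hab hac hx.2.1 hx.1 hy.2.1 hy.1
      have e2 : interlaceOn (pivot (pivot G b a) b d) ((S.erase a).erase d) =
          interlaceOn (pivot G b d) ((S.erase a).erase d) := by
        refine hid _ _ _ (lt2 a ha d) ?_
        intro x hx y hy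
        simp only [Finset.mem_erase] at hx hy
        exact pivot_pivot_adj G hda.symm hab.symm hbd hx.2.1 hx.1 hy.2.1 hy.1
      rw [e1, e2, pivot_comm G b a, Finset.erase_right_comm (a := b) (b := a)]
      abel
    -- two edges at a common vertex
    have adj : ∀ (a b c : V), a ∈ S → b ∈ S → c ∈ S → b ≠ c → G.Adj a b → G.Adj a c →
        interlaceOn G (S.erase a) + interlaceOn (pivot G a b) (S.erase b) =
        interlaceOn G (S.erase a) + interlaceOn (pivot G a c) (S.erase c) := by
      intro a b c ha hb hc hbc hab hac
      have nab := hab.ne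
      have nac := hac.ne
      have nbc := hbc
      rw [hrec (pivot G a b) (S.erase b) a c (lt1 b hb) (by simp [*])
          (by simp [*, nbc.symm]) ((pivot_adj_left G a b c).mpr hac),
        hrec (pivot G a c) (S.erase c) b a (lt1 c hc) (by simp [*])
          (by simp [*]) ((pivot_adj_left G a c b).mpr hab).symm]
      have e1 : interlaceOn (pivot (pivot G a b) a c) ((S.erase b).erase c) =
          interlaceOn (pivot G a c) ((S.erase b).erase c) := by
        refine hid _ _ _ (lt2 b hb c) ?_
        intro x hx y hy
        simp only [Finset.mem_erase] at hx hy
        exact pivot_pivot_adj G hbc hab hac hx.2.1 hx.1 hy.2.1 hy.1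
      have e2 : interlaceOn (pivot G a b) ((S.erase b).erase a) =
          interlaceOn (pivot (pivot G a c) b a) ((S.erase c).erase a) := by
        have him : ((S.erase b).erase a).image (Equiv.swap b c) = (S.erase c).erase a := by
          ext w
          simp only [Finset.mem_image, Finset.mem_erase]
          constructor
          · rintro ⟨x, ⟨hxa, hxb, hx⟩, rfl⟩
            by_cases hxc : x = c
            · subst hxc; simp [nab.symm, hbc, hb]
            · rw [Equiv.swap_apply_of_ne_of_ne hxb hxc]; exact ⟨hxa, hxc, hx⟩
          · rintro ⟨hwa, hwc, hw⟩
            by_cases hwb : w = b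
            · subst hwb; exact ⟨c, ⟨nac.symm, hbc.symm, hc⟩, by simp⟩
            · exact ⟨w, ⟨hwa, hwb, hw⟩, Equiv.swap_apply_of_ne_of_ne hwb hwc⟩
        rw [← him]
        refine hiso _ _ _ _ (lt2 b hb a) (Equiv.injective _).injOn ?_
        intro x hx y hy
        simp only [Finset.mem_erase] at hx hy
        obtain ⟨hxa, hxb, -⟩ := hx
        obtain ⟨hya, hyb, -⟩ := hy
        rw [pivot_comm _ b a]
        have hsame : ∀ x y, x ≠ a → x ≠ b → x ≠ c → y ≠ a → y ≠ b → y ≠ c →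
            ((pivot G a b).Adj x y ↔ (pivot (pivot G a c) a b).Adj x y) := by
          intro x y _ hxb hxc _ hyb hyc
          exact (pivot_pivot_adj G hbc.symm hac hab hxc hxb hyc hyb).symm
        by_cases hxc : x = c
        · subst hxc
          by_cases hyc : y = x
          · subst hyc; simp
          · rw [Equiv.swap_apply_right, Equiv.swap_apply_of_ne_of_ne hyb hyc]
            exact pivot_pivot_adj_swap G hbc hab hac hya hyb hyc
        · by_cases hyc : y = c
          · subst hyc
            rw [Equiv.swap_apply_right, Equiv.swap_apply_of_ne_of_ne hxb hxc,
              SimpleGraph.adj_comm, SimpleGraph.adj_comm _ x]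
            exact pivot_pivot_adj_swap G hbc hab hac hxa hxb hxc
          · rw [Equiv.swap_apply_of_ne_of_ne hyb hyc, Equiv.swap_apply_of_ne_of_ne hxb hxc]
            exact hsame x y hxa hxb hxc hya hyb hyc
      rw [e1, e2, Finset.erase_right_comm (a := c) (b := b)]
      abel
    have adj' : ∀ (a b c : V), a ∈ S → b ∈ S → c ∈ S → G.Adj a b → G.Adj a c →
        interlaceOn G (S.erase a) + interlaceOn (pivot G a b) (S.erase b) =
        interlaceOn G (S.erase a) + interlaceOn (pivot G a c) (S.erase c) := by
      intro a b c ha hb hc hab hac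
      by_cases hbc : b = c
      · rw [hbc]
      · exact adj a b c ha hb hc hbc hab hac
    -- two edges joined by a further edge
    have con : ∀ (a b c d : V), a ∈ S → b ∈ S → c ∈ S → d ∈ S → G.Adj a b → G.Adj c d →
        G.Adj b c →
        interlaceOn G (S.erase a) + interlaceOn (pivot G a b) (S.erase b) =
        interlaceOn G (S.erase c) + interlaceOn (pivot G c d) (S.erase d) := by
      intro a b c d ha hb hc hd hab hcd hbc
      rw [rev a b ha hb hab, adj' b a c hb ha hc hab.symm hbc, rev b c hb hc hbc,
        adj' c b d hc hb hd hbc.symm hcd]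
    intro a b ha hb hab c d hc hd hcd
    by_cases hbc : G.Adj b c
    · exact con a b c d ha hb hc hd hab hcd hbc
    by_cases hbd : G.Adj b d
    · rw [rev c d hc hd hcd]
      exact con a b d c ha hb hd hc hab hcd.symm hbd
    by_cases hac : G.Adj a c
    · rw [rev a b ha hb hab]
      exact con b a c d hb ha hc hd hab.symm hcd hac
    by_cases had : G.Adj a d
    · rw [rev a b ha hb hab, rev c d hc hd hcd]
      exact con b a d c hb ha hd hc hab.symm hcd.symm had
    have nac : a ≠ c := fun h => had (h ▸ hcd)
    have nad : a ≠ d := fun h => hac (h ▸ hcd.symm)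
    have nbc : b ≠ c := fun h => hbd (h ▸ hcd)
    have nbd : b ≠ d := fun h => hbc (h ▸ hcd.symm)
    rw [hrec G (S.erase a) c d (lt1 a ha) (by simp [*, nac.symm]) (by simp [*, nad.symm]) hcd,
      hrec (pivot G a b) (S.erase b) c d (lt1 b hb) (by simp [*, nbc.symm])
        (by simp [*, nbd.symm]) ((pivot_adj_of_not G a b c d hac hbc).mpr hcd),
      hrec G (S.erase c) a b (lt1 c hc) (by simp [*]) (by simp [*]) hab,
      hrec (pivot G c d) (S.erase d) a b (lt1 d hd) (by simp [*])
        (by simp [*]) ((pivot_adj_of_not G c d a b (fun h => hac h.symm)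
          (fun h => had h.symm)).mpr hab)]
    have e : interlaceOn (pivot (pivot G a b) c d) ((S.erase b).erase d) =
        interlaceOn (pivot (pivot G c d) a b) ((S.erase b).erase d) := by
      refine hid _ _ _ (lt2 b hb d) ?_
      intro x _ y _
      have hca : ¬ G.Adj c a := fun h => hac h.symm
      have hcb : ¬ G.Adj c b := fun h => hbc h.symm
      have hda : ¬ G.Adj d a := fun h => had h.symm
      have hdb : ¬ G.Adj d b := fun h => hbd h.symm
      have e1 : ∀ z, (pivot G a b).Adj c z ↔ G.Adj c z :=
        fun z => pivot_adj_of_not G a b c z hac hbc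
      have e2 : ∀ z, (pivot G a b).Adj d z ↔ G.Adj d z :=
        fun z => pivot_adj_of_not G a b d z had hbd
      have e3 : ∀ z, (pivot G c d).Adj a z ↔ G.Adj a z :=
        fun z => pivot_adj_of_not G c d a z hca hda
      have e4 : ∀ z, (pivot G c d).Adj b z ↔ G.Adj b z :=
        fun z => pivot_adj_of_not G c d b z hcb hdb
      have t1 : PivotToggles (pivot G a b) c d x y ↔ PivotToggles G c d x y := by
        simp only [PivotToggles, e1, e2]
      have t2 : PivotToggles (pivot G c d) a b x y ↔ PivotToggles G a b x y := by
        simp only [PivotToggles, e3, e4]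
      change ¬ (¬ (G.Adj x y ↔ PivotToggles G a b x y) ↔ PivotToggles (pivot G a b) c d x y) ↔
        ¬ (¬ (G.Adj x y ↔ PivotToggles G c d x y) ↔ PivotToggles (pivot G c d) a b x y)
      rw [t1, t2]
      tauto
    rw [e, Finset.erase_right_comm (a := c) (b := a), Finset.erase_right_comm (a := c) (b := b),
      Finset.erase_right_comm (a := d) (b := a), Finset.erase_right_comm (a := d) (b := b)]
    abel
  obtain ⟨c, hc, d, hd, hcd, e⟩ := interlaceOn_exists G S ha hb hab
  rw [e]
  exact (key a b ha hb hab c d hc hd hcd).symm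

theorem interlacePoly_bot {V : Type*} [Fintype V] :
    interlacePoly (⊥ : SimpleGraph V) = X ^ Fintype.card V :=
  interlaceOn_edgeless _ _ (by simp)

theorem interlacePoly_induce {V : Type*} [Fintype V] [DecidableEq V] (G : SimpleGraph V)
    (a : V) : interlacePoly (G.induce {x | x ≠ a}) = interlaceOn G (Finset.univ.erase a) := by
  classical
  rw [interlacePoly, interlaceOn_congr_aux _
    (fun H T _ _ _ ha hb hab => interlaceOn_pivot H T ha hb hab) _ _ G _ Subtype.val le_rfl rfl
    Subtype.val_injective.injOn (by simp)]
  congr 1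
  ext x
  simp

/-- The defining recursion `q(G) = q(G - a) + q(G^{ab} - b)` holds for every edge `ab`; together
with `interlacePoly_bot` it determines `interlacePoly`. -/
theorem interlacePoly_pivot {V : Type*} [Fintype V] [DecidableEq V] (G : SimpleGraph V)
    {a b : V} (hab : G.Adj a b) :
    interlacePoly G = interlacePoly (G.induce {x | x ≠ a}) +
      interlacePoly ((pivot G a b).induce {x | x ≠ b}) := by
  rw [interlacePoly_induce, interlacePoly_induce, interlacePoly,
    interlaceOn_pivot G Finset.univ (Finset.mem_univ a) (Finset.mem_univ b) hab]
  congr!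

/-- The graph `H[K_1, …, K_n]` obtained by substituting the graphs `K i` for the vertices `i`
of `H`: the disjoint union of the `K i`, with all vertices of `K i` joined to all vertices of
`K j` whenever `ij` is an edge of `H`. -/
def substitute {ι : Type*} (H : SimpleGraph ι) {W : ι → Type*} (K : ∀ i, SimpleGraph (W i)) :
    SimpleGraph (Σ i, W i) :=
  (⨆ i, (K i).map (Function.Embedding.sigmaMk i)) ⊔ H.comap Sigma.fst

/-- `G` is a solid `H`-graph: up to isomorphism, it arises from the template `H` by substituting
a (non-null) complete graph for each vertex. -/
def IsSolid {ι : Type v} (H : SimpleGraph ι) {V : Type u} (G : SimpleGraph V) : Prop :=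
  ∃ W : ι → Type u, (∀ i, Nonempty (W i)) ∧
    Nonempty (G ≃g substitute H (fun i => (⊤ : SimpleGraph (W i))))

/-- `G` is the union of two complete graphs, with vertex sets `A` and `B`, sharing some but not
all of their vertices. -/
def IsTwoOverlappingComplete {V : Type*} (G : SimpleGraph V) : Prop :=
  ∃ A B : Set V, A ∪ B = Set.univ ∧ (A ∩ B).Nonempty ∧ (A \ B).Nonempty ∧ (B \ A).Nonempty ∧
    ∀ x y, G.Adj x y ↔ x ≠ y ∧ ((x ∈ A ∧ y ∈ A) ∨ (x ∈ B ∧ y ∈ B))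

/-- The set of values `q_G(1)` over all graphs `G` of order `n`. -/
def interlaceValuesAtOne (n : ℕ) : Set ℚ :=
  {r | ∃ (V : Type u) (_ : Fintype V) (G : SimpleGraph V), Fintype.card V = n ∧
    r = (((interlacePoly G).eval 1 : ℤ) : ℚ)}

/-- `r` is the second-largest element of `S`: the largest one after removal of the maximum. -/
def IsSecondLargest (S : Set ℚ) (r : ℚ) : Prop :=
  ∃ m, IsGreatest S m ∧ IsGreatest (S \ {m}) r

/-!
Throughout, `N(S)` is the value at one for the subgraph induced by a vertex set `S`, so that
`N(S) = N(S - a) + N'(S - b)` for each edge `ab`, where `N'` refers to the pivot `G^{ab}`. By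
induction `N(S) ≤ 2 ^ (|S| - 1)`. Between adjacent twins the pivot changes nothing
(`interlaceValue_twins`), so each further twin doubles `N`: complete graphs attain the bound, and
two overlapping complete graphs have the value `3 * 2 ^ (|S| - 3)` of the path with two edges
(`IsOverlap.isSubextremal`).

A vertex keeps its neighbours when pivoting on an edge at it. Hence if `a` has a neighbour `b` and a
non-neighbour, and `G - a` is incomplete, both summands are incomplete and the bound
`3 * 2 ^ (|S| - 3)` follows by induction; if there is no such `a`, an incomplete graph with an edge
is a complete graph minus an edge, which is an overlap of two complete graphs
(`eight_mul_interlaceValue_le`).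

If an incomplete graph attains this bound, then so do both summands for every edge for which both
are incomplete. This inheritance shows that `G` is connected
(`not_isSubextremal_of_disconnected`) and contains neither three pairwise non-adjacent vertices nor
an induced path or cycle on four vertices (`Obstruction.not_isSubextremal`). Given non-adjacent
vertices `x`, `y`, these exclusions say that the closed neighbourhoods of `x` and `y` are cliques
that cover `G` and every edge, and connectedness makes them meet (`IsSubextremal.isOverlap`).
-/

/-! ### The value at one and its recursion -/

/-- The value `q(1)` of the interlace polynomial of the subgraph of `G` induced by `S`. -/
noncomputable def interlaceValue {V : Type*} (G : SimpleGraph V) (S : Finset V) : ℤ :=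
  (interlaceOn G S).eval 1

/-- `interlaceValue G S` attains the second-largest value `3 / 4 * 2 ^ (|S| - 1)`, written without
division or subtraction. -/
def IsSubextremal {V : Type*} (G : SimpleGraph V) (S : Finset V) : Prop :=
  8 * interlaceValue G S = 3 * 2 ^ S.card

theorem interlaceOn_congr {V : Type*} {G H : SimpleGraph V} {S : Finset V}
    (h : ∀ x ∈ S, ∀ y ∈ S, (G.Adj x y ↔ H.Adj x y)) : interlaceOn G S = interlaceOn H S := by
  classical
  have := interlaceOn_congr_aux S.card
    (fun H T _ _ _ ha hb hab => interlaceOn_pivot H T ha hb hab) _ G H S id le_rfl rfl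
    (Set.injOn_id _) h
  simpa using this

theorem interlaceValue_edgeless {V : Type*} {G : SimpleGraph V} {S : Finset V}
    (h : ∀ a ∈ S, ∀ b ∈ S, ¬ G.Adj a b) : interlaceValue G S = 1 := by
  simp [interlaceValue, interlaceOn_edgeless G S h]

open Classical in
theorem interlaceValue_pivot {V : Type*} {G : SimpleGraph V} {S : Finset V} {a b : V}
    (ha : a ∈ S) (hb : b ∈ S) (hab : G.Adj a b) :
    interlaceValue G S =
      interlaceValue G (S.erase a) + interlaceValue (pivot G a b) (S.erase b) := by
  simp only [interlaceValue, interlaceOn_pivot G S ha hb hab, eval_add]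

open Classical in
/-- Pivoting on an edge between two adjacent twins toggles nothing. -/
theorem interlaceValue_twins {V : Type*} {G : SimpleGraph V} {S : Finset V} {a b : V}
    (ha : a ∈ S) (hb : b ∈ S) (hab : G.Adj a b)
    (h : ∀ x ∈ S, x ≠ a → x ≠ b → (G.Adj a x ↔ G.Adj b x)) :
    interlaceValue G S = interlaceValue G (S.erase a) + interlaceValue G (S.erase b) := by
  rw [interlaceValue_pivot ha hb hab]
  congr 1
  unfold interlaceValue
  congr 1
  refine interlaceOn_congr fun x hx y hy => ?_
  have hx := h x (Finset.mem_of_mem_erase hx)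
  have hy := h y (Finset.mem_of_mem_erase hy)
  have : ¬ PivotToggles G a b x y := by
    unfold PivotToggles; tauto
  simp [pivot, this]

theorem two_pow_card_erase {V : Type*} [DecidableEq V] {S : Finset V} {a : V} (ha : a ∈ S) :
    (2 : ℤ) ^ S.card = 2 * 2 ^ (S.erase a).card := by
  rw [← Finset.card_erase_add_one ha, pow_succ, mul_comm]

/-! ### The largest value -/

theorem two_mul_interlaceValue_le {V : Type*} (G : SimpleGraph V) (S : Finset V)
    (hS : S.Nonempty) : 2 * interlaceValue G S ≤ 2 ^ S.card := by
  classical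
  induction hn : S.card using Nat.strong_induction_on generalizing G S with
  | _ n ih =>
  subst hn
  by_cases hE : ∃ a ∈ S, ∃ b ∈ S, G.Adj a b
  · obtain ⟨a, ha, b, hb, hab⟩ := hE
    have h1 := ih _ (Finset.card_erase_lt_of_mem ha) G (S.erase a)
      ⟨b, by simp [hb, hab.ne']⟩ rfl
    have h2 := ih _ (Finset.card_erase_lt_of_mem hb) (pivot G a b) (S.erase b)
      ⟨a, by simp [ha, hab.ne]⟩ rfl
    have e1 := two_pow_card_erase ha
    have e2 := two_pow_card_erase hb
    rw [interlaceValue_pivot ha hb hab]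
    linarith
  · push Not at hE
    rw [interlaceValue_edgeless hE]
    calc (2 : ℤ) * 1 = 2 ^ 1 := by norm_num
      _ ≤ 2 ^ S.card := pow_le_pow_right₀ (by norm_num) hS.card_pos

theorem two_mul_interlaceValue_of_isClique {V : Type*} {G : SimpleGraph V} {S : Finset V}
    (hS : S.Nonempty) (hG : G.IsClique S) : 2 * interlaceValue G S = 2 ^ S.card := by
  classical
  induction hn : S.card using Nat.strong_induction_on generalizing S with
  | _ n ih =>
  subst hn
  obtain ⟨a, rfl⟩ | ⟨a, ha, b, hb, hne⟩ := hS.exists_eq_singleton_or_nontrivial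
  · rw [interlaceValue_edgeless (by simp)]
    simp
  · have ha : a ∈ S := ha
    have hb : b ∈ S := hb
    have hab : G.Adj a b := hG ha hb hne
    have mono : ∀ c, G.IsClique (S.erase c) := fun c =>
      hG.subset (by simp)
    have h1 := ih _ (Finset.card_erase_lt_of_mem ha) (S := S.erase a)
      ⟨b, by simp [hb, hab.ne']⟩ (mono a) rfl
    have h2 := ih _ (Finset.card_erase_lt_of_mem hb) (S := S.erase b)
      ⟨a, by simp [ha, hab.ne]⟩ (mono b) rfl
    have e1 := two_pow_card_erase ha
    have e2 := two_pow_card_erase hb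
    rw [interlaceValue_twins ha hb hab fun x hx hxa hxb =>
      iff_of_true (hG ha hx hxa.symm) (hG hb hx hxb.symm)]
    linarith

/-! ### Two overlapping cliques -/

/-- The subgraph of `G` induced by `S` is the union of two complete graphs, on `S ∩ A` and
`S ∩ B`, that share some but not all of their vertices. -/
structure IsOverlap {V : Type*} (G : SimpleGraph V) (S : Finset V) (A B : Set V) : Prop where
  cover : ∀ x ∈ S, x ∈ A ∨ x ∈ B
  inter : ∃ z ∈ S, z ∈ A ∧ z ∈ B
  left : ∃ x ∈ S, x ∈ A ∧ x ∉ B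
  right : ∃ y ∈ S, y ∈ B ∧ y ∉ A
  adj : ∀ x ∈ S, ∀ y ∈ S, G.Adj x y ↔ x ≠ y ∧ ((x ∈ A ∧ y ∈ A) ∨ (x ∈ B ∧ y ∈ B))

open Classical in
/-- Of two vertices on the same sides, one can be dropped. -/
theorem IsOverlap.erase {V : Type*} {G : SimpleGraph V} {S : Finset V} {A B : Set V}
    (h : IsOverlap G S A B) {u v : V} (hv : v ∈ S) (huv : u ≠ v)
    (hA : u ∈ A ↔ v ∈ A) (hB : u ∈ B ↔ v ∈ B) : IsOverlap G (S.erase u) A B := by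
  have aux : ∀ P : V → Prop, (P u → P v) → (∃ x ∈ S, P x) → ∃ x ∈ S.erase u, P x := by
    rintro P hP ⟨x, hx, hPx⟩
    by_cases hxu : x = u
    · exact ⟨v, by simp [hv, huv.symm], hP (hxu ▸ hPx)⟩
    · exact ⟨x, by simp [hx, hxu], hPx⟩
  exact ⟨fun x hx => h.cover x (Finset.mem_of_mem_erase hx),
    aux _ (by tauto) h.inter, aux _ (by tauto) h.left, aux _ (by tauto) h.right,
    fun x hx y hy => h.adj x (Finset.mem_of_mem_erase hx) y (Finset.mem_of_mem_erase hy)⟩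

/-- Two vertices on the same sides are adjacent twins, so dropping one of them halves the value;
this reduces to the path with two edges. -/
theorem IsOverlap.isSubextremal {V : Type*} {G : SimpleGraph V} {S : Finset V} {A B : Set V}
    (h : IsOverlap G S A B) : IsSubextremal G S := by
  classical
  unfold IsSubextremal
  induction hn : S.card using Nat.strong_induction_on generalizing S with
  | _ n ih =>
  subst hn
  by_cases ht : ∃ u ∈ S, ∃ v ∈ S, u ≠ v ∧ (u ∈ A ↔ v ∈ A) ∧ (u ∈ B ↔ v ∈ B)
  · obtain ⟨u, hu, v, hv, huv, hA, hB⟩ := ht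
    have h1 := ih _ (Finset.card_erase_lt_of_mem hu) (h.erase hv huv hA hB) rfl
    have h2 := ih _ (Finset.card_erase_lt_of_mem hv) (h.erase hu huv.symm hA.symm hB.symm) rfl
    have e1 := two_pow_card_erase hu
    have e2 := two_pow_card_erase hv
    have hadj : G.Adj u v := (h.adj u hu v hv).mpr ⟨huv, by
      have := h.cover u hu
      tauto⟩
    rw [interlaceValue_twins hu hv hadj fun x hx hxu hxv => by
      rw [h.adj u hu x hx, h.adj v hv x hx]
      simp only [ne_eq, hxu.symm, hxv.symm, hA, hB]]
    linarith
  · obtain ⟨z, hz, hzA, hzB⟩ := h.inter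
    obtain ⟨x, hx, hxA, hxB⟩ := h.left
    obtain ⟨y, hy, hyB, hyA⟩ := h.right
    have hxz : x ≠ z := fun e => hxB (e ▸ hzB)
    have hyz : y ≠ z := fun e => hyA (e ▸ hzA)
    have hxy : x ≠ y := fun e => hxB (e ▸ hyB)
    have hS : S = {x, y, z} := by
      ext w
      simp only [Finset.mem_insert, Finset.mem_singleton]
      refine ⟨fun hw => ?_, by rintro (rfl | rfl | rfl) <;> assumption⟩
      by_contra! hne
      have := h.cover w hw
      have h1 := fun hA hB => ht ⟨w, hw, x, hx, hne.1, hA, hB⟩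
      have h2 := fun hA hB => ht ⟨w, hw, y, hy, hne.2.1, hA, hB⟩
      have h3 := fun hA hB => ht ⟨w, hw, z, hz, hne.2.2, hA, hB⟩
      tauto
    have axz : G.Adj x z := (h.adj x hx z hz).mpr ⟨hxz, Or.inl ⟨hxA, hzA⟩⟩
    have ayz : G.Adj y z := (h.adj y hy z hz).mpr ⟨hyz, Or.inr ⟨hyB, hzB⟩⟩
    have axy : ¬ G.Adj x y := fun e => by
      have := (h.adj x hx y hy).mp e
      tauto
    have e1 : S.erase x = {y, z} := by
      rw [hS]; exact Finset.erase_insert (by simp [hxy, hxz])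
    have e2 : S.erase z = {x, y} := by
      rw [hS]; ext w; simp only [Finset.mem_erase, Finset.mem_insert, Finset.mem_singleton]
      constructor
      · tauto
      · rintro (rfl | rfl) <;> simp [*]
    have v1 := two_mul_interlaceValue_of_isClique (G := G) (S := {y, z}) (by simp)
      (by simp [SimpleGraph.isClique_insert, ayz])
    have v2 : interlaceValue (pivot G x z) {x, y} = 1 := by
      have h1 : ¬ (pivot G x z).Adj x y := by rwa [pivot_adj_left]
      have h2 : ¬ (pivot G x z).Adj y x := fun e => h1 e.symm
      refine interlaceValue_edgeless ?_
      simp [h1, h2]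
    rw [Finset.card_pair hyz] at v1
    rw [interlaceValue_pivot hx hz axz, e1, e2, v2, hS, Finset.card_insert_of_notMem (by
      simp [hxy, hxz]), Finset.card_pair hyz]
    norm_num at v1 ⊢
    linarith

/-! ### The bound for incomplete graphs -/

theorem not_isClique_of_not_adj {V : Type*} {G : SimpleGraph V} {S : Finset V} {x y : V}
    (hx : x ∈ S) (hy : y ∈ S) (hne : x ≠ y) (h : ¬ G.Adj x y) : ¬ G.IsClique S :=
  fun hc => h (hc hx hy hne)

theorem exists_not_adj_of_not_isClique {V : Type*} {G : SimpleGraph V} {S : Finset V}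
    (h : ¬ G.IsClique S) : ∃ x ∈ S, ∃ y ∈ S, x ≠ y ∧ ¬ G.Adj x y := by
  by_contra! h'
  exact h fun x hx y hy => h' x hx y hy

open Classical in
/-- A vertex that has a non-neighbour keeps it when pivoting on an edge at this vertex. -/
theorem not_isClique_pivot {V : Type*} {G : SimpleGraph V} {S : Finset V} {a b c : V}
    (ha : a ∈ S) (hc : c ∈ S) (hab : G.Adj a b) (hca : c ≠ a) (hac : ¬ G.Adj a c) :
    ¬ (pivot G a b).IsClique (S.erase b) := by
  have hcb : c ≠ b := fun e => hac (e ▸ hab)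
  refine not_isClique_of_not_adj (x := a) (y := c) (by simp [ha, hab.ne]) (by simp [hc, hcb])
    hca.symm ?_
  rwa [pivot_adj_left]

/-- If some vertex `a` with a neighbour has a non-neighbour and `G - a` is incomplete, pivoting
at `a` leads to two incomplete graphs; otherwise `G` is a complete graph minus an edge. -/
theorem eight_mul_interlaceValue_le {V : Type*} {G : SimpleGraph V} {S : Finset V}
    (hG : ¬ G.IsClique S) : 8 * interlaceValue G S ≤ 3 * 2 ^ S.card := by
  classical
  induction hn : S.card using Nat.strong_induction_on generalizing G S with
  | _ n ih =>
  subst hn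
  obtain ⟨a, ha, c, hc, hac, nac⟩ := exists_not_adj_of_not_isClique hG
  by_cases hE : ∃ u ∈ S, ∃ v ∈ S, G.Adj u v
  swap
  · push Not at hE
    rw [interlaceValue_edgeless hE]
    have h2 : 2 ≤ S.card := Finset.one_lt_card.mpr ⟨a, ha, c, hc, hac⟩
    calc (8 : ℤ) * 1 ≤ 3 * 2 ^ 2 := by norm_num
      _ ≤ 3 * 2 ^ S.card := by gcongr; norm_num
  by_cases hA : ∃ u ∈ S, ∃ v ∈ S, ∃ w ∈ S,
      G.Adj u v ∧ w ≠ u ∧ ¬ G.Adj u w ∧ ¬ G.IsClique (S.erase u)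
  · obtain ⟨u, hu, v, hv, w, hw, huv, hwu, huw, hcl⟩ := hA
    have h1 := ih _ (Finset.card_erase_lt_of_mem hu) hcl rfl
    have h2 := ih _ (Finset.card_erase_lt_of_mem hv)
      (not_isClique_pivot hu hw huv hwu huw) rfl
    have e1 := two_pow_card_erase hu
    have e2 := two_pow_card_erase hv
    rw [interlaceValue_pivot hu hv huv]
    linarith
  push Not at hA
  have hnbr : ∀ a ∈ S, ∃ b ∈ S, G.Adj a b := by
    intro a ha
    by_contra! hiso
    obtain ⟨u, hu, v, hv, huv⟩ := hE
    have hau : a ≠ u := fun e => hiso v hv (e ▸ huv)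
    have hav : a ≠ v := fun e => hiso u hu (e ▸ huv.symm)
    refine not_isClique_of_not_adj (x := a) (y := v) (by simp [ha, hau])
      (by simp [hv, huv.ne']) hav (hiso v hv) (hA u hu v hv a ha huv hau ?_)
    exact fun e => hiso u hu e.symm
  obtain ⟨b, hb, hab⟩ := hnbr a ha
  obtain ⟨d, hd, hcd⟩ := hnbr c hc
  have k1 := hA a ha b hb c hc hab hac.symm nac
  have k2 := hA c hc d hd a ha hcd hac fun e => nac e.symm
  have hbc : b ≠ c := fun e => nac (e ▸ hab)
  refine le_of_eq (IsOverlap.isSubextremal (A := {x | x ≠ a}) (B := {x | x ≠ c})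
    ⟨?_, ⟨b, hb, hab.ne', hbc⟩, ⟨c, hc, hac.symm, by simp⟩, ⟨a, ha, hac, by simp⟩, ?_⟩)
  · intro x _
    by_cases hxa : x = a
    · exact Or.inr (by simp [hxa, hac])
    · exact Or.inl hxa
  · intro x hx y hy
    simp only [Set.mem_ofPred_eq]
    constructor
    · intro hxy
      refine ⟨hxy.ne, ?_⟩
      by_contra! hcon
      by_cases hxa : x = a
      · exact nac (hxa ▸ hcon.2 (hxa ▸ hac) ▸ hxy)
      · have hya := hcon.1 hxa
        by_cases hxc : x = c
        · exact nac (hxc ▸ hya ▸ hxy.symm)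
        · exact hac (hya.symm.trans (hcon.2 hxc))
    · rintro ⟨hxy, ⟨h1, h2⟩ | ⟨h1, h2⟩⟩
      · exact k1 (by simp [hx, h1]) (by simp [hy, h2]) hxy
      · exact k2 (by simp [hx, h1]) (by simp [hy, h2]) hxy

/-! ### Graphs attaining the bound -/

open Classical in
/-- In a subextremal graph, an edge whose two summands are both incomplete has both summands
subextremal. -/
theorem IsSubextremal.of_pivot {V : Type*} {G : SimpleGraph V} {S : Finset V}
    (h : IsSubextremal G S) {a b : V} (ha : a ∈ S) (hb : b ∈ S) (hab : G.Adj a b)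
    (h1 : ¬ G.IsClique (S.erase a)) (h2 : ¬ (pivot G a b).IsClique (S.erase b)) :
    IsSubextremal G (S.erase a) ∧ IsSubextremal (pivot G a b) (S.erase b) := by
  have k1 := eight_mul_interlaceValue_le h1
  have k2 := eight_mul_interlaceValue_le h2
  have e1 := two_pow_card_erase ha
  have e2 := two_pow_card_erase hb
  unfold IsSubextremal at *
  rw [interlaceValue_pivot ha hb hab] at h
  constructor <;> linarith

theorem not_isSubextremal_of_edgeless {V : Type*} {G : SimpleGraph V} {S : Finset V}
    (h : ∀ a ∈ S, ∀ b ∈ S, ¬ G.Adj a b) : ¬ IsSubextremal G S := by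
  intro hs
  rw [IsSubextremal, interlaceValue_edgeless h] at hs
  omega

theorem IsSubextremal.not_isClique {V : Type*} {G : SimpleGraph V} {S : Finset V}
    (h : IsSubextremal G S) : ¬ G.IsClique S := by
  intro hc
  rcases S.eq_empty_or_nonempty with rfl | hS
  · exact not_isSubextremal_of_edgeless (by simp) h
  · have := two_mul_interlaceValue_of_isClique hS hc
    have h2 : (0 : ℤ) < 2 ^ S.card := by positivity
    unfold IsSubextremal at h
    linarith

/-- Disconnectedness passes to both summands of the recursion. -/
theorem not_isSubextremal_of_disconnected {V : Type*} {G : SimpleGraph V} {S : Finset V}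
    (P : V → Prop) {x y : V} (hx : x ∈ S) (hy : y ∈ S) (hPx : P x) (hPy : ¬ P y)
    (hP : ∀ u ∈ S, ∀ v ∈ S, G.Adj u v → (P u ↔ P v)) : ¬ IsSubextremal G S := by
  classical
  induction hn : S.card using Nat.strong_induction_on generalizing G S x y with
  | _ n ih =>
  subst hn
  by_cases hE : ∃ a ∈ S, ∃ b ∈ S, G.Adj a b
  swap
  · push Not at hE
    exact not_isSubextremal_of_edgeless hE
  intro hs
  obtain ⟨a, ha, b, hb, hab⟩ := hE
  have hPab := hP a ha b hb hab
  have aux : ∀ a b, b ∈ S → a ≠ b → (P a ↔ P b) →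
      ∃ x ∈ S.erase a, ∃ y ∈ S.erase a, P x ∧ ¬ P y := by
    intro a b hb hne hPab
    by_cases hxa : x = a
    · refine ⟨b, by simp [hb, hne.symm], y, ?_, hPab.mp (hxa ▸ hPx), hPy⟩
      refine Finset.mem_erase.mpr ⟨?_, hy⟩
      rintro rfl
      exact hPy (hxa ▸ hPx)
    · by_cases hya : y = a
      · exact ⟨x, by simp [hx, hxa], b, by simp [hb, hne.symm], hPx,
          fun e => hPy (hya ▸ hPab.mpr e)⟩
      · exact ⟨x, by simp [hx, hxa], y, by simp [hy, hya], hPx, hPy⟩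
  have hP' : ∀ u ∈ S, ∀ v ∈ S, (pivot G a b).Adj u v → (P u ↔ P v) := by
    intro u hu v hv huv
    by_cases hadj : G.Adj u v
    · exact hP u hu v hv hadj
    have ht : PivotToggles G a b u v := by
      by_contra ht
      exact huv (iff_of_false hadj ht)
    have hnbr : ∀ w ∈ S, G.Adj a w ∨ G.Adj b w → (P a ↔ P w) := fun w hw h =>
      h.elim (hP a ha w hw) fun e => hPab.trans (hP b hb w hw e)
    exact (hnbr u hu ht.1.2.2).symm.trans (hnbr v hv ht.2.1.2.2)
  obtain ⟨x₁, hx₁, y₁, hy₁, hPx₁, hPy₁⟩ := aux a b hb hab.ne hPab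
  obtain ⟨x₂, hx₂, y₂, hy₂, hPx₂, hPy₂⟩ := aux b a ha hab.ne' hPab.symm
  refine ih _ (Finset.card_erase_lt_of_mem ha) (G := G) (S := S.erase a) hx₁ hy₁ hPx₁ hPy₁
    (fun u hu v hv => hP u (Finset.mem_of_mem_erase hu) v (Finset.mem_of_mem_erase hv)) rfl
    (hs.of_pivot ha hb hab ?_ ?_).1
  · exact not_isClique_of_not_adj hx₁ hy₁ (by rintro rfl; exact hPy₁ hPx₁) fun e => hPy₁
      ((hP _ (Finset.mem_of_mem_erase hx₁) _ (Finset.mem_of_mem_erase hy₁) e).mp hPx₁)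
  · exact not_isClique_of_not_adj hx₂ hy₂ (by rintro rfl; exact hPy₂ hPx₂) fun e => hPy₂
      ((hP' _ (Finset.mem_of_mem_erase hx₂) _ (Finset.mem_of_mem_erase hy₂) e).mp hPx₂)

theorem IsSubextremal.exists_adj {V : Type*} {G : SimpleGraph V} {S : Finset V}
    (h : IsSubextremal G S) {w v : V} (hw : w ∈ S) (hv : v ∈ S) (hvw : v ≠ w) :
    ∃ b ∈ S, G.Adj w b := by
  by_contra! hiso
  refine not_isSubextremal_of_disconnected (· = w) hw hv rfl hvw ?_ h
  intro u hu u' hu' huu'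
  refine iff_of_false ?_ ?_
  · rintro rfl; exact hiso _ hu' huu'
  · rintro rfl; exact hiso _ hu huu'.symm

open Classical in
theorem IsSubextremal.erase {V : Type*} {G : SimpleGraph V} {S : Finset V}
    (h : IsSubextremal G S) {w v : V} (hw : w ∈ S) (hv : v ∈ S) (hvw : v ≠ w)
    (hwv : ¬ G.Adj w v) (hcl : ¬ G.IsClique (S.erase w)) : IsSubextremal G (S.erase w) := by
  obtain ⟨b, hb, hwb⟩ := h.exists_adj hw hv hvw
  exact (h.of_pivot hw hb hwb hcl (not_isClique_pivot hw hv hwb hvw hwv)).1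

/-- An obstruction to being subextremal: three pairwise non-adjacent vertices, or an induced path
or cycle `p q r s` on four vertices (`p` and `s` may or may not be adjacent). -/
inductive Obstruction {V : Type*} (G : SimpleGraph V) (S : Finset V) : Prop
  | indep (x y z : V) (hx : x ∈ S) (hy : y ∈ S) (hz : z ∈ S) (hxy : x ≠ y) (hxz : x ≠ z)
      (hyz : y ≠ z) (nxy : ¬ G.Adj x y) (nxz : ¬ G.Adj x z) (nyz : ¬ G.Adj y z)
  | path (p q r s : V) (hp : p ∈ S) (hq : q ∈ S) (hr : r ∈ S) (hs : s ∈ S)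
      (hpr : p ≠ r) (hqs : q ≠ s) (apq : G.Adj p q) (aqr : G.Adj q r) (ars : G.Adj r s)
      (npr : ¬ G.Adj p r) (nqs : ¬ G.Adj q s)

/-- A further vertex `w` can be deleted if it has a non-neighbour; if `w` is adjacent to all
others, pivoting on an edge from `w` to the obstruction leaves an obstruction. -/
theorem Obstruction.not_isSubextremal {V : Type*} {G : SimpleGraph V} {S : Finset V}
    (ho : Obstruction G S) : ¬ IsSubextremal G S := by
  classical
  induction hn : S.card using Nat.strong_induction_on generalizing G S with
  | _ n ih =>
  subst hn
  intro h
  have step : ∀ w ∈ S, Obstruction G (S.erase w) → ¬ G.IsClique (S.erase w) →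
      ∀ v ∈ S, v ≠ w → G.Adj w v := by
    intro w hw ho' hcl v hv hvw
    by_contra hwv
    exact ih _ (Finset.card_erase_lt_of_mem hw) ho' rfl (h.erase hw hv hvw hwv hcl)
  have step' : ∀ a ∈ S, ∀ w ∈ S, G.Adj a w → ¬ G.IsClique (S.erase a) →
      ¬ (pivot G a w).IsClique (S.erase w) → ¬ Obstruction (pivot G a w) (S.erase w) :=
    fun a ha w hw haw h1 h2 ho' => ih _ (Finset.card_erase_lt_of_mem hw) ho' rfl
      (h.of_pivot ha hw haw h1 h2).2
  cases ho with
  | indep x y z hx hy hz hxy hxz hyz nxy nxz nyz =>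
    by_cases hw : ∃ w ∈ S, w ≠ x ∧ w ≠ y ∧ w ≠ z
    · obtain ⟨w, hw, hwx, hwy, hwz⟩ := hw
      have mx : x ∈ S.erase w := by simp [hx, hwx.symm]
      have my : y ∈ S.erase w := by simp [hy, hwy.symm]
      have mz : z ∈ S.erase w := by simp [hz, hwz.symm]
      have dom := step w hw (.indep x y z mx my mz hxy hxz hyz nxy nxz nyz)
        (not_isClique_of_not_adj mx my hxy nxy)
      have pyz : ¬ (pivot G x w).Adj y z := by
        simp [pivot, PivotToggles, nxy, nxz, nyz, dom y hy hwy.symm, dom z hz hwz.symm]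
      refine step' x hx w hw (dom x hx hwx.symm).symm
        (not_isClique_of_not_adj (x := y) (y := z) (by simp [hy, hxy.symm])
          (by simp [hz, hxz.symm]) hyz nyz) (not_isClique_of_not_adj my mz hyz pyz) ?_
      refine .indep x y z mx my mz hxy hxz hyz ?_ ?_ pyz <;> rwa [pivot_adj_left]
    · obtain ⟨b, hb, hxb⟩ := h.exists_adj hx hy hxy.symm
      refine hw ⟨b, hb, hxb.ne', ?_, ?_⟩
      · rintro rfl; exact nxy hxb
      · rintro rfl; exact nxz hxb
  | path p q r s hp hq hr hs hpr hqs apq aqr ars npr nqs =>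
    have hps : p ≠ s := by rintro rfl; exact npr ars.symm
    have hpcl : ¬ G.IsClique (S.erase p) := not_isClique_of_not_adj (x := q) (y := s)
      (by simp [hq, apq.ne']) (by simp [hs, hps.symm]) hqs nqs
    by_cases hw : ∃ w ∈ S, w ≠ p ∧ w ≠ q ∧ w ≠ r ∧ w ≠ s
    · obtain ⟨w, hw, hwp, hwq, hwr, hws⟩ := hw
      have mp : p ∈ S.erase w := by simp [hp, hwp.symm]
      have mq : q ∈ S.erase w := by simp [hq, hwq.symm]
      have mr : r ∈ S.erase w := by simp [hr, hwr.symm]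
      have ms : s ∈ S.erase w := by simp [hs, hws.symm]
      have dom := step w hw (.path p q r s mp mq mr ms hpr hqs apq aqr ars npr nqs)
        (not_isClique_of_not_adj mp mr hpr npr)
      have dq := dom q hq hwq.symm
      have dr := dom r hr hwr.symm
      have ds := dom s hs hws.symm
      have awp := (dom p hp hwp.symm).symm
      refine step' p hp w hw awp hpcl (not_isClique_pivot hp hr awp hpr.symm npr) ?_
      have pqr : ¬ (pivot G p w).Adj q r := by
        simp [pivot, PivotToggles, *, apq.ne', hpr.symm, hwq.symm, hwr.symm]
      by_cases aps : G.Adj p s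
      · -- the edges from the neighbours `q`, `s` of `p` to `r` disappear
        refine .indep q r s mq mr ms aqr.ne hqs ars.ne pqr ?_ ?_
        · simp [pivot, PivotToggles, *]
        · simp [pivot, PivotToggles, *, hps.symm, hpr.symm, hws.symm, hwr.symm]
      · -- `q` exchanges its neighbour `r` for `s`
        refine .path p q s r mp mq ms mr hps aqr.ne ?_ ?_ ?_ ?_ pqr
        · rwa [pivot_adj_left]
        · simp [pivot, PivotToggles, *, apq.ne', hps.symm, hwq.symm, hws.symm]
        · simp [pivot, PivotToggles, *, ars.symm]
        · rwa [pivot_adj_left]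
    · -- on four vertices, pivoting on `p q` leaves an isolated vertex: `r` if `p s` is an edge,
      -- and `p` otherwise
      have mem : ∀ w ∈ S.erase q, w = p ∨ w = r ∨ w = s := by
        intro w hw'
        simp only [Finset.mem_erase] at hw'
        by_contra! hne
        exact hw ⟨w, hw'.2, hne.1, hw'.1, hne.2.1, hne.2.2⟩
      have h2 := (h.of_pivot hp hq apq hpcl
        (not_isClique_pivot hp hr apq hpr.symm npr)).2
      have mp : p ∈ S.erase q := by simp [hp, apq.ne]
      have mr : r ∈ S.erase q := by simp [hr, aqr.ne']
      by_cases aps : G.Adj p s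
      · obtain ⟨b, hb, hrb⟩ := h2.exists_adj mr mp hpr
        rcases mem b hb with rfl | rfl | rfl
        · exact npr ((pivot_adj_left G _ _ _).mp hrb.symm)
        · exact hrb.ne rfl
        · simp [pivot, PivotToggles, *, hps.symm, hpr.symm, hqs.symm, aqr.ne'] at hrb
      · obtain ⟨b, hb, hpb⟩ := h2.exists_adj mp mr hpr.symm
        rw [pivot_adj_left] at hpb
        rcases mem b hb with rfl | rfl | rfl
        · exact hpb.ne rfl
        · exact npr hpb
        · exact aps hpb

/-- For non-adjacent `x`, `y`, the two cliques are the closed neighbourhoods of `x` and `y`. -/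
theorem IsSubextremal.isOverlap {V : Type*} {G : SimpleGraph V} {S : Finset V}
    (h : IsSubextremal G S) : ∃ A B : Set V, IsOverlap G S A B := by
  obtain ⟨x, hx, y, hy, hxy, nxy⟩ := exists_not_adj_of_not_isClique h.not_isClique
  have hI : ∀ x ∈ S, ∀ y ∈ S, ∀ z ∈ S, x ≠ y → x ≠ z → y ≠ z → ¬ G.Adj x y → ¬ G.Adj x z →
      G.Adj y z := by
    intro x hx y hy z hz hxy hxz hyz nxy nxz
    by_contra nyz
    exact Obstruction.not_isSubextremal (.indep x y z hx hy hz hxy hxz hyz nxy nxz nyz) h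
  have hQ : ∀ p ∈ S, ∀ q ∈ S, ∀ r ∈ S, ∀ s ∈ S, p ≠ r → q ≠ s → G.Adj p q → G.Adj q r →
      G.Adj r s → ¬ G.Adj p r → G.Adj q s := by
    intro p hp q hq r hr s hs hpr hqs apq aqr ars npr
    by_contra nqs
    exact Obstruction.not_isSubextremal
      (.path p q r s hp hq hr hs hpr hqs apq aqr ars npr nqs) h
  have cover : ∀ v ∈ S, (v = x ∨ G.Adj x v) ∨ (v = y ∨ G.Adj y v) := by
    intro v hv
    by_contra! hcon
    exact nxy (hI v hv x hx y hy hcon.1.1 hcon.2.1 hxy (fun e => hcon.1.2 e.symm)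
      fun e => hcon.2.2 e.symm)
  have cross : ∀ u ∈ S, ∀ v ∈ S, G.Adj u v → (u = x ∨ G.Adj x u) ∨ (v = y ∨ G.Adj y v) := by
    intro u hu v hv huv
    by_contra! hcon
    obtain ⟨⟨hux, nxu⟩, ⟨hvy, nyv⟩⟩ := hcon
    have axv : G.Adj x v := by
      rcases cover v hv with (rfl | e) | e | e
      · exact absurd huv.symm nxu
      · exact e
      · exact absurd e hvy
      · exact absurd e nyv
    have ayu : G.Adj y u := by
      rcases cover u hu with (e | e) | rfl | e
      · exact absurd e hux
      · exact absurd e nxu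
      · exact absurd huv nyv
      · exact e
    -- otherwise `x v u y` is an induced path
    exact nyv (hQ x hx v hv u hu y hy hux.symm hvy axv huv.symm ayu.symm nxu).symm
  have clique : ∀ x ∈ S, ∀ y ∈ S, x ≠ y → ¬ G.Adj x y → ∀ u ∈ S, ∀ v ∈ S, u ≠ v →
      (u = x ∨ G.Adj x u) → (v = x ∨ G.Adj x v) → G.Adj u v := by
    rintro x hx y hy hxy nxy u hu v hv huv (rfl | axu) (rfl | axv)
    · exact absurd rfl huv
    · exact axv
    · exact axu.symm
    have nyx : ¬ G.Adj y x := fun e => nxy e.symm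
    -- if `u`, `v` were not adjacent, `y u x v` or `y v x u` would be a path or cycle, or `y, u, v`
    -- independent
    by_cases ayu : G.Adj y u
    · exact hQ y hy u hu x hx v hv hxy.symm huv ayu axu.symm axv nyx
    by_cases ayv : G.Adj y v
    · exact (hQ y hy v hv x hx u hu hxy.symm huv.symm ayv axv.symm axu nyx).symm
    · refine hI y hy u hu v hv ?_ ?_ huv ayu ayv
      · rintro rfl; exact nxy axu
      · rintro rfl; exact nxy axv
  have split : ∀ p q r s : Prop, p ∨ q → r ∨ s → p ∨ s → r ∨ q → (p ∧ r) ∨ (q ∧ s) := by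
    tauto
  have key : ∀ u ∈ S, ∀ v ∈ S, G.Adj u v ↔
      u ≠ v ∧ (((u = x ∨ G.Adj x u) ∧ (v = x ∨ G.Adj x v)) ∨
        ((u = y ∨ G.Adj y u) ∧ (v = y ∨ G.Adj y v))) := by
    intro u hu v hv
    constructor
    · intro huv
      have c1 := cover u hu
      have c2 := cover v hv
      have c3 := cross u hu v hv huv
      have c4 := cross v hv u hu huv.symm
      exact ⟨huv.ne, split _ _ _ _ c1 c2 c3 c4⟩
    · rintro ⟨huv, ⟨h1, h2⟩ | ⟨h1, h2⟩⟩
      · exact clique x hx y hy hxy nxy u hu v hv huv h1 h2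
      · exact clique y hy x hx hxy.symm (fun e => nxy e.symm) u hu v hv huv h1 h2
  refine ⟨{v | v = x ∨ G.Adj x v}, {v | v = y ∨ G.Adj y v}, ?_, ?_, ⟨x, hx, ?_⟩, ⟨y, hy, ?_⟩, key⟩
  · exact cover
  · by_contra hZ
    refine not_isSubextremal_of_disconnected (fun v => v = x ∨ G.Adj x v) hx hy (by simp)
      (by simp [hxy.symm, nxy]) ?_ h
    intro u hu v hv huv
    obtain ⟨-, ⟨h1, h2⟩ | ⟨h1, h2⟩⟩ := (key u hu v hv).mp huv
    · exact iff_of_true h1 h2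
    · exact iff_of_false (fun e => hZ ⟨u, hu, e, h1⟩) fun e => hZ ⟨v, hv, e, h2⟩
  · exact ⟨Or.inl rfl, by simp [hxy, G.adj_comm y x, nxy]⟩
  · exact ⟨Or.inl rfl, by simp [hxy.symm, nxy]⟩

/-! ### Solid graphs over the path with two edges -/

theorem substitute_top_adj {ι : Type*} (H : SimpleGraph ι) {W : ι → Type*}
    (p q : Σ i, W i) : (substitute H fun i => (⊤ : SimpleGraph (W i))).Adj p q ↔
      (p ≠ q ∧ p.1 = q.1) ∨ H.Adj p.1 q.1 := by
  obtain ⟨i, x⟩ := p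
  obtain ⟨j, y⟩ := q
  simp only [substitute, SimpleGraph.sup_adj, SimpleGraph.iSup_adj, SimpleGraph.map_adj,
    SimpleGraph.top_adj, SimpleGraph.comap_adj, Function.Embedding.sigmaMk_apply]
  refine or_congr_left ⟨?_, ?_⟩
  · rintro ⟨k, u, v, huv, h1, h2⟩
    cases h1
    cases h2
    simpa using huv
  · rintro ⟨hne, rfl⟩
    exact ⟨i, x, y, fun e => hne (by rw [e]), rfl, rfl⟩

/-- Being solid over the path with two edges, in terms of the map to the template. -/
theorem isSolid_pathGraph_three_iff {V : Type u} (G : SimpleGraph V) :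
    IsSolid (SimpleGraph.pathGraph 3) G ↔ ∃ c : V → Fin 3, Function.Surjective c ∧
      ∀ x y, G.Adj x y ↔ x ≠ y ∧ ((c x ≤ 1 ∧ c y ≤ 1) ∨ (1 ≤ c x ∧ 1 ≤ c y)) := by
  have hpath : ∀ i j : Fin 3, (i = j ∨ (SimpleGraph.pathGraph 3).Adj i j) ↔
      ((i ≤ 1 ∧ j ≤ 1) ∨ (1 ≤ i ∧ 1 ≤ j)) := by
    simp only [SimpleGraph.pathGraph_adj]
    decide
  constructor
  · rintro ⟨W, hW, ⟨f⟩⟩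
    refine ⟨fun x => (f x).1, fun i => ?_, fun x y => ?_⟩
    · obtain ⟨w⟩ := hW i
      exact ⟨f.symm ⟨i, w⟩, by simp⟩
    · rw [← f.map_adj_iff, substitute_top_adj, ← hpath, ← f.injective.ne_iff]
      have : (SimpleGraph.pathGraph 3).Adj (f x).1 (f y).1 → f x ≠ f y := fun h e =>
        h.ne (congrArg Sigma.fst e)
      tauto
  · rintro ⟨c, hc, hadj⟩
    refine ⟨fun i => {x // c x = i}, fun i => ?_, ⟨⟨(Equiv.sigmaFiberEquiv c).symm, ?_⟩⟩⟩
    · obtain ⟨x, hx⟩ := hc i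
      exact ⟨⟨x, hx⟩⟩
    · intro x y
      rw [substitute_top_adj, (Equiv.injective _).ne_iff, hadj, ← hpath]
      have h1 : ∀ x, ((Equiv.sigmaFiberEquiv c).symm x).1 = c x := fun x => rfl
      have : (SimpleGraph.pathGraph 3).Adj (c x) (c y) → x ≠ y := fun h e =>
        h.ne (congrArg c e)
      rw [h1, h1]
      tauto

theorem isSolid_and_ne_top_iff {V : Type u} (G : SimpleGraph V) :
    IsSolid (SimpleGraph.pathGraph 3) G ∧ G ≠ ⊤ ↔ IsTwoOverlappingComplete G := by
  classical
  rw [isSolid_pathGraph_three_iff]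
  constructor
  · rintro ⟨⟨c, hc, hadj⟩, -⟩
    obtain ⟨x, hx⟩ := hc 0
    obtain ⟨z, hz⟩ := hc 1
    obtain ⟨y, hy⟩ := hc 2
    refine ⟨{v | c v ≤ 1}, {v | 1 ≤ c v}, ?_, ⟨z, ?_⟩, ⟨x, ?_⟩, ⟨y, ?_⟩, hadj⟩
    · ext v
      simpa using le_total (c v) 1
    · simp [hz]
    · simp [hx]
    · simp [hy]
  · rintro ⟨A, B, hAB, ⟨z, hzA, hzB⟩, ⟨x, hxA, hxB⟩, ⟨y, hyB, hyA⟩, hadj⟩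
    have cover : ∀ v, v ∈ A ∨ v ∈ B := fun v => hAB.ge (Set.mem_univ v)
    refine ⟨⟨fun v => if v ∉ B then 0 else if v ∈ A then 1 else 2, ?_, ?_⟩, ?_⟩
    · intro i
      fin_cases i
      · exact ⟨x, by simp [hxB]⟩
      · exact ⟨z, by simp [hzA, hzB]⟩
      · exact ⟨y, by simp [hyA, hyB]⟩
    · intro u v
      rw [hadj]
      have h1 : ∀ v, (if v ∉ B then (0 : Fin 3) else if v ∈ A then 1 else 2) ≤ 1 ↔ v ∈ A := by
        intro v
        have := cover v
        split_ifs <;> simp <;> tauto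
      have h2 : ∀ v, 1 ≤ (if v ∉ B then (0 : Fin 3) else if v ∈ A then 1 else 2) ↔ v ∈ B := by
        intro v
        split_ifs <;> simp <;> tauto
      rw [h1, h1, h2, h2]
    · rintro rfl
      have := (hadj x y).mp (by rintro rfl; exact hxB hyB)
      tauto

/-! ### The second-largest value -/

theorem isTwoOverlappingComplete_iff_isSubextremal {V : Type*} [Fintype V] (G : SimpleGraph V) :
    IsTwoOverlappingComplete G ↔ IsSubextremal G Finset.univ := by
  constructor
  · rintro ⟨A, B, hAB, ⟨z, hzA, hzB⟩, ⟨x, hxA, hxB⟩, ⟨y, hyB, hyA⟩, hadj⟩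
    exact IsOverlap.isSubextremal (A := A) (B := B) ⟨fun v _ => hAB.ge (Set.mem_univ v),
      ⟨z, by simp, hzA, hzB⟩, ⟨x, by simp, hxA, hxB⟩, ⟨y, by simp, hyB, hyA⟩,
      fun u _ v _ => hadj u v⟩
  · intro h
    obtain ⟨A, B, hc, ⟨z, -, hz⟩, ⟨x, -, hx⟩, ⟨y, -, hy⟩, hadj⟩ := h.isOverlap
    exact ⟨A, B, Set.eq_univ_of_forall fun v => hc v (by simp), ⟨z, hz⟩, ⟨x, hx⟩, ⟨y, hy⟩,
      fun u v => hadj u (by simp) v (by simp)⟩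

theorem eq_top_iff_isClique_univ {V : Type*} [Fintype V] (G : SimpleGraph V) :
    G = ⊤ ↔ G.IsClique (Finset.univ : Finset V) := by
  simp

theorem proposition52 (n : ℕ) (hn : 3 ≤ n) :
    IsSecondLargest (interlaceValuesAtOne.{u} n) (3 / 4 * 2 ^ (n - 1)) ∧
    ∀ (V : Type u) [Fintype V] (G : SimpleGraph V), Fintype.card V = n →
      ((((interlacePoly G).eval 1 : ℤ) : ℚ) = 3 / 4 * 2 ^ (n - 1) ↔
        IsSolid (SimpleGraph.pathGraph 3) G ∧ G ≠ ⊤) ∧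
      (IsSolid (SimpleGraph.pathGraph 3) G ∧ G ≠ ⊤ ↔ IsTwoOverlappingComplete G) := by
  have hpow : (2 : ℚ) ^ n = 2 * 2 ^ (n - 1) := by
    rw [← pow_succ', Nat.sub_add_cancel (by omega)]
  have hpos : (0 : ℚ) < 2 ^ (n - 1) := by positivity
  have value_eq_iff : ∀ (V : Type u) [Fintype V] (G : SimpleGraph V), Fintype.card V = n →
      ((((interlacePoly G).eval 1 : ℤ) : ℚ) = 3 / 4 * 2 ^ (n - 1) ↔
        IsTwoOverlappingComplete G) := by
    intro V _ G hV
    rw [isTwoOverlappingComplete_iff_isSubextremal, IsSubextremal, Finset.card_univ, hV,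
      ← Int.cast_inj (α := ℚ)]
    push_cast
    rw [hpow]
    change _ ↔ 8 * (((interlacePoly G).eval 1 : ℤ) : ℚ) = _
    constructor <;> intro h <;> linarith
  have nonempty : ∀ (V : Type u) [Fintype V], Fintype.card V = n →
      (Finset.univ : Finset V).Nonempty := by
    intro V _ hV
    rw [← Finset.card_pos, Finset.card_univ]
    omega
  have value_top : ∀ (V : Type u) [Fintype V], Fintype.card V = n →
      (((interlacePoly (⊤ : SimpleGraph V)).eval 1 : ℤ) : ℚ) = 2 ^ (n - 1) := by
    intro V _ hV
    have h := two_mul_interlaceValue_of_isClique (nonempty V hV)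
      ((eq_top_iff_isClique_univ (⊤ : SimpleGraph V)).mp rfl)
    rw [Finset.card_univ, hV, ← Int.cast_inj (α := ℚ)] at h
    push_cast at h
    rw [hpow] at h
    change 2 * (((interlacePoly (⊤ : SimpleGraph V)).eval 1 : ℤ) : ℚ) = _ at h
    linarith
  have hcard : Fintype.card (ULift.{u} (Fin n)) = n := by simp
  refine ⟨⟨2 ^ (n - 1), ⟨⟨_, inferInstance, ⊤, hcard, (value_top _ hcard).symm⟩, ?_⟩,
    ⟨?_, ?_⟩, ?_⟩, fun V _ G hV => ⟨?_, isSolid_and_ne_top_iff G⟩⟩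
  · rintro r ⟨V, _, G, hV, rfl⟩
    have h := two_mul_interlaceValue_le G Finset.univ (nonempty V hV)
    rw [Finset.card_univ, hV, ← Int.cast_le (R := ℚ)] at h
    push_cast at h
    rw [hpow] at h
    change 2 * (((interlacePoly G).eval 1 : ℤ) : ℚ) ≤ _ at h
    linarith
  · -- the complete graph minus the edge between the vertices `0` and `1`
    let v₀ : ULift.{u} (Fin n) := ⟨⟨0, by omega⟩⟩
    let v₁ : ULift.{u} (Fin n) := ⟨⟨1, by omega⟩⟩
    let v₂ : ULift.{u} (Fin n) := ⟨⟨2, by omega⟩⟩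
    have h01 : v₀ ≠ v₁ := by simp [v₀, v₁]
    have h20 : v₂ ≠ v₀ := by simp [v₀, v₂]
    have h21 : v₂ ≠ v₁ := by simp [v₁, v₂]
    let G : SimpleGraph (ULift.{u} (Fin n)) :=
      { Adj := fun x y => x ≠ y ∧ ((x ≠ v₀ ∧ y ≠ v₀) ∨ (x ≠ v₁ ∧ y ≠ v₁))
        symm := ⟨fun _ _ h => ⟨h.1.symm, h.2.imp And.symm And.symm⟩⟩
        loopless := ⟨fun _ h => h.1 rfl⟩ }
    refine ⟨_, inferInstance, G, hcard, ((value_eq_iff _ G hcard).mpr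
      ⟨{x | x ≠ v₀}, {x | x ≠ v₁}, ?_, ⟨v₂, h20, h21⟩, ⟨v₁, h01.symm, fun h => h rfl⟩,
        ⟨v₀, h01, fun h => h rfl⟩, fun x y => Iff.rfl⟩).symm⟩
    refine Set.eq_univ_of_forall fun x => ?_
    by_cases hx : x = v₀
    · exact Or.inr (hx ▸ h01)
    · exact Or.inl hx
  · intro h
    simp only [Set.mem_singleton_iff] at h
    linarith
  · rintro r ⟨⟨V, _, G, hV, rfl⟩, hne⟩
    have hG : G ≠ ⊤ := by
      rintro rfl
      exact hne (value_top V hV)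
    have h := eight_mul_interlaceValue_le fun hc => hG ((eq_top_iff_isClique_univ G).mpr hc)
    rw [Finset.card_univ, hV, ← Int.cast_le (R := ℚ)] at h
    push_cast at h
    rw [hpow] at h
    change 8 * (((interlacePoly G).eval 1 : ℤ) : ℚ) ≤ _ at h
    linarith
  · rw [value_eq_iff V G hV, isSolid_and_ne_top_iff]
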